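/- Let $A$ be a set (alphabet, possibly infinite), $A^*$ the free monoid on $A$, and $K$ a nonzero ring with unit. Let $c:K\langle A\rangle\to K\langle A\rangle\otimes K\langle A\rangle$ be the coproduct dual to the shuffle product, i.e. the morphism of algebras with $c(a)=a\otimes 1+1\otimes a$ for every letter $a$. A polynomial $P\in K\langle A\rangle$ is called primitive if $c(P)=P\otimes 1+1\otimes P$. A congruence $\equiv$ on $A^*$, with natural map $\mathrm{nat}:K\langle A\rangle\to K[A^*/_\equiv]$, is called $K$-shuffle compatible if there is a linear map $c_\equiv:K[A^*/_\equiv]\to K[A^*/_\equiv]\otimes K[A^*/_\equiv]$ with $c_\equiv\circ \mathrm{nat}=(\mathrm{nat}\otimes \mathrm{nat})\circ c$. Theorem. Let $\equiv$ be a finitely generated congruence on $A^*$ which is $K$-shuffle compatible and which is generated by relators $u\equiv v$ $(u,v\in A^*)$ such that $u-v$ is primitive in $K\langle A\rangle$. Then at least one of the following holds. 1. The monoid $A^*/_\equiv$ is not cancellable (i.e. not both left and right cancellative). 2. There is a weight function $\omega:A\to\mathbb N^*=\{1,2,\dots\}$ for which $\equiv$ is homogeneous, i.e. $u\equiv v$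 implies $\omega(u)=\omega(v)$, where $\omega(a_1\cdots a_n)=\omega(a_1)+\cdots+\omega(a_n)$; and $A^*/_\equiv$ embeds in a group. More precisely: every element of $A^*/_\equiv$ has only finitely many factorizations $xy$; the set $1+\mathcal M_K(A^*/_\equiv)$ of all formal series $S:A^*/_\equiv\to K$ with constant term $S(1)=1$ is a group under the product $(ST)(m)=\sum_{xy=m}S(x)T(y)$ (the Magnus group); the Magnus transformation $\mu$ (the endomorphism of the algebra $K\langle A\rangle$ with $\mu(a)=1+a$ for every letter $a$) induces an endomorphism $\mu_\equiv$ of $K[A^*/_\equiv]$, with $\mu_\equiv\circ \mathrm{nat}=\mathrm{nat}\circ\mu$; and the restriction of $\mu_\equiv$ to $A^*/_\equiv$ is an injective morphism of monoids into $1+\mathcal M_K(A^*/_\equiv)$. -/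

import Mathlib

open MonoidAlgebra

noncomputable section

namespace ShuffleCongruence

/-! `A*` is `FreeMonoid A`, `K⟨A⟩` is `MonoidAlgebra K (FreeMonoid A)`. For a semiring `K` that
need not be commutative, `K[M] ⊗ K[N]` is `MonoidAlgebra K (M × N)`, with the pair `(x, y)` in the
place of `x ⊗ y`. -/

section Semiring

variable {A M : Type*} [Monoid M] (K : Type*) [Semiring K]

theorem commute_lift_of_letters (f : A → MonoidAlgebra K M)
    (hf : ∀ (k : K) (a : A), Commute (single (1 : M) k) (f a)) (k : K) (w : FreeMonoid A) :
    Commute ((singleOneRingHom : K →+* MonoidAlgebra K M) k) (FreeMonoid.lift f w) := by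
  induction w using FreeMonoid.inductionOn' with
  | one => simp
  | of_mul a w ih =>
    rw [map_mul, FreeMonoid.lift_eval_of]
    exact (hf k a).mul_right ih

/-- The morphism `K⟨A⟩ → K[M]` that fixes `K` and sends each letter `a` to `f a`, where the
elements `f a` commute with the scalars. -/
def extendLetters (f : A → MonoidAlgebra K M)
    (hf : ∀ (k : K) (a : A), Commute (single (1 : M) k) (f a)) :
    MonoidAlgebra K (FreeMonoid A) →+* MonoidAlgebra K M :=
  liftNCRingHom singleOneRingHom (FreeMonoid.lift f) (commute_lift_of_letters K f hf)

variable (A) in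
/-- The coproduct dual to the shuffle product: the morphism `c : K⟨A⟩ → K⟨A⟩ ⊗ K⟨A⟩` with
`c a = a ⊗ 1 + 1 ⊗ a` for each letter `a`. -/
def coprod : MonoidAlgebra K (FreeMonoid A) →+* MonoidAlgebra K (FreeMonoid A × FreeMonoid A) :=
  extendLetters K
    (fun a => single (FreeMonoid.of a, 1) 1 + single (1, FreeMonoid.of a) 1)
    (fun k a => by simp [Commute, SemiconjBy, mul_add, add_mul, Prod.one_eq_mk])

variable (A) in
/-- The Magnus transformation: the endomorphism of `K⟨A⟩` with `a ↦ 1 + a` for each letter `a`. -/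
def magnus : MonoidAlgebra K (FreeMonoid A) →+* MonoidAlgebra K (FreeMonoid A) :=
  extendLetters K (fun a => 1 + single (FreeMonoid.of a) 1)
    (fun k a => by simp [Commute, SemiconjBy, mul_add, add_mul, one_def])

/-- The natural morphism `nat : K⟨A⟩ → K[A*/≡]`. -/
def nat (r : Con (FreeMonoid A)) :
    MonoidAlgebra K (FreeMonoid A) →+* MonoidAlgebra K r.Quotient :=
  mapDomainRingHom K r.mk'

/-- The morphism `nat ⊗ nat : K⟨A⟩ ⊗ K⟨A⟩ → K[A*/≡] ⊗ K[A*/≡]`. -/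
def natTensor (r : Con (FreeMonoid A)) :
    MonoidAlgebra K (FreeMonoid A × FreeMonoid A) →+*
      MonoidAlgebra K (r.Quotient × r.Quotient) :=
  mapDomainRingHom K (r.mk'.prodMap r.mk')

/-- `≡` is compatible with the shuffle product over `K`: there is a coproduct
`c_≡ : K[A*/≡] → K[A*/≡] ⊗ K[A*/≡]` with `c_≡ ∘ nat = (nat ⊗ nat) ∘ c`. -/
def ShuffleCompatible (r : Con (FreeMonoid A)) : Prop :=
  ∃ c' : MonoidAlgebra K r.Quotient →ₗ[K] MonoidAlgebra K (r.Quotient × r.Quotient),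
    ∀ P : MonoidAlgebra K (FreeMonoid A), c' (nat K r P) = natTensor K r (coprod A K P)

variable {K}

/-- `P ∈ K⟨A⟩` is primitive: `c P = P ⊗ 1 + 1 ⊗ P`. -/
def IsPrimitive (P : MonoidAlgebra K (FreeMonoid A)) : Prop :=
  coprod A K P =
    mapDomainRingHom K (MonoidHom.inl (FreeMonoid A) (FreeMonoid A)) P +
      mapDomainRingHom K (MonoidHom.inr (FreeMonoid A) (FreeMonoid A)) P

/-- `μ'` is the endomorphism `μ_≡` of `K[A*/≡]` that the Magnus transformation `μ` induces:
`μ_≡ ∘ nat = nat ∘ μ`. -/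
def IsInducedMagnus (r : Con (FreeMonoid A))
    (μ' : MonoidAlgebra K r.Quotient →+* MonoidAlgebra K r.Quotient) : Prop :=
  ∀ P : MonoidAlgebra K (FreeMonoid A), μ' (nat K r P) = nat K r (magnus A K P)

/-- The (Cauchy) product of two series `S, T ∈ K⟪M⟫`, that is, functions `M → K`:
`(S T)(m) = ∑_{x y = m} S(x) T(y)`. It is meaningful when each `m` has only finitely many
factorizations. -/
def seriesMul (S T : M → K) : M → K :=
  fun m => ∑ᶠ p ∈ {p : M × M | p.1 * p.2 = m}, S p.1 * T p.2

variable (K M) in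
/-- The set `1 + 𝓜_K(M)` of the series over `M` with constant term `1`, where `𝓜_K(M)` is the set
of the series with constant term `0`. -/
def MagnusSeries : Type _ := {S : M → K // S 1 = 1}

end Semiring

section Congruence

variable {A : Type*}

/-- The congruence on `A*` generated by a set of relators. -/
def generatedBy (R : Set (FreeMonoid A × FreeMonoid A)) : Con (FreeMonoid A) :=
  conGen fun u v => (u, v) ∈ R

/-- `≡` is finitely generated. -/
def FinitelyGenerated (r : Con (FreeMonoid A)) : Prop :=
  ∃ R : Set (FreeMonoid A × FreeMonoid A), R.Finite ∧ r = generatedBy R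

/-- `≡` is generated by relators `u ≡ v` such that `u - v` is primitive in `K⟨A⟩`. -/
def PrimitivelyGenerated (K : Type*) [Ring K] (r : Con (FreeMonoid A)) : Prop :=
  ∃ R : Set (FreeMonoid A × FreeMonoid A),
    (∀ u v : FreeMonoid A, (u, v) ∈ R → IsPrimitive (single u (1 : K) - single v (1 : K))) ∧
      r = generatedBy R

/-- The weight of a word: the sum of the weights of its letters, with multiplicity. -/
def weight (ω : A → ℕ+) (w : FreeMonoid A) : ℕ :=
  (w.toList.map fun a => (ω a : ℕ)).sum

/-- `≡` is homogeneous for `ω`. -/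
def Homogeneous (r : Con (FreeMonoid A)) (ω : A → ℕ+) : Prop :=
  ∀ u v : FreeMonoid A, r u v → weight ω u = weight ω v

/-- The series over `A*/≡` with constant term `1` form a group under the product of series
(in which all the sums are finite), and the Magnus transformation induces an endomorphism of
`K[A*/≡]` whose restriction to `A*/≡` is an injective morphism of monoids into this group. -/
def EmbedsInMagnusGroup (K : Type*) [Ring K] (r : Con (FreeMonoid A)) : Prop :=
  (∀ m : r.Quotient, {p : r.Quotient × r.Quotient | p.1 * p.2 = m}.Finite) ∧
  ∃ _ : Group (MagnusSeries r.Quotient K),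
    (∀ S T : MagnusSeries r.Quotient K, (S * T).val = seriesMul S.val T.val) ∧
    ∃ μ' : MonoidAlgebra K r.Quotient →+* MonoidAlgebra K r.Quotient,
      IsInducedMagnus r μ' ∧
      ∃ φ : r.Quotient →* MagnusSeries r.Quotient K,
        Function.Injective φ ∧
        ∀ m x : r.Quotient, (φ m).val x = (μ' (single m 1)).coeff x

end Congruence

end ShuffleCongruence

end

/-! The coefficient of `c w` at `(x, y)` counts the sets of positions at which `w` splits into the
subword `x` and the complementary subword `y`. If `u - v` is primitive, these counts agree in `K`
for nonempty `x` and `y`. If `u` has two distinct letters, let `x` collect all occurrences of one of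
them: the count for `u` is exactly 1, nonzero in every characteristic, so `v` splits in the same way
and is a rearrangement of `u`. Hence each relator either permutes letters or has the form `a ^ i ≡ b
^ j` (`IsPrimitive.perm_or_pow`).

When the quotient is cancellative, letters have infinite order in it, so the relations `a ^ i ≡ b ^
j` prescribe consistent ratios of weights. Only finitely many letters are constrained, and
denominators can be cleared (`exists_homogeneous`). Positive weights make factorizations finite and
allow series to be inverted by recursion on weight.

Finally `μ` is `c` followed by erasing the second factor, so `μ u - μ v = u - v` for a primitive
binomial and `μ` descends to the quotient. Since `μ w` is `w` plus lighter terms, its top component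
recovers `w`, whence injectivity. -/

noncomputable section

namespace ShuffleCongruence

/-! ### Splittings of words and primitive binomials -/

/-- The ways of splitting a list into a sublist and the complementary sublist, one for each
subset of the set of positions. -/
def splits {A : Type*} : List A → List (List A × List A)
  | [] => [([], [])]
  | a :: l => (splits l).map (fun p => (a :: p.1, p.2)) ++ (splits l).map (fun p => (p.1, a :: p.2))

theorem perm_of_mem_splits {A : Type*} {l : List A} {p : List A × List A} (hp : p ∈ splits l) :
    (p.1 ++ p.2).Perm l := by
  induction l generalizing p with
  | nil => simp only [splits, List.mem_singleton] at hp; simp [hp]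
  | cons a l ih =>
    simp only [splits, List.mem_append, List.mem_map] at hp
    rcases hp with ⟨q, hq, rfl⟩ | ⟨q, hq, rfl⟩
    · exact (ih hq).cons a
    · exact List.perm_middle.trans ((ih hq).cons a)

/-- The positions of the first part are forced: they are those whose letter satisfies `P`. -/
theorem count_splits_filter {A : Type*} [DecidableEq A] (P : A → Prop) [DecidablePred P]
    (l : List A) :
    (splits l).count (l.filter P, l.filter (¬ P ·)) = 1 := by
  induction l with
  | nil => simp [splits]
  | cons a l ih =>
    have hinj₁ : Function.Injective fun p : List A × List A => (a :: p.1, p.2) := by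
      rintro ⟨x, y⟩ ⟨x', y'⟩ h; simpa using h
    have hinj₂ : Function.Injective fun p : List A × List A => (p.1, a :: p.2) := by
      rintro ⟨x, y⟩ ⟨x', y'⟩ h; simpa using h
    by_cases ha : P a
    · rw [List.filter_cons_of_pos (by simpa using ha), List.filter_cons_of_neg (by simpa using ha),
        splits, List.count_append,
        List.count_map_of_injective _ _ hinj₁ (l.filter P, l.filter (¬ P ·)), ih,
        List.count_eq_zero.2]
      rintro h
      obtain ⟨q, -, hq⟩ := List.mem_map.1 h
      have : a ∈ l.filter (¬ P ·) := (Prod.mk.inj hq).2 ▸ List.mem_cons_self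
      simp [ha] at this
    · rw [List.filter_cons_of_neg (by simpa using ha), List.filter_cons_of_pos (by simpa using ha),
        splits, List.count_append,
        List.count_map_of_injective _ _ hinj₂ (l.filter P, l.filter (¬ P ·)), ih,
        List.count_eq_zero.2]
      rintro h
      obtain ⟨q, -, hq⟩ := List.mem_map.1 h
      have : a ∈ l.filter P := (Prod.mk.inj hq).1 ▸ List.mem_cons_self
      simp [ha] at this

theorem toList_of_pow {A : Type*} (a : A) (n : ℕ) :
    (FreeMonoid.of a ^ n).toList = List.replicate n a := by
  induction n with
  | zero => simp
  | succ n ih => rw [pow_succ', FreeMonoid.toList_mul, ih]; rfl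

section Semiring

variable {A : Type*} {K : Type*} [Semiring K]

theorem extendLetters_single {M : Type*} [Monoid M] (f : A → MonoidAlgebra K M)
    (hf : ∀ (k : K) (a : A), Commute (single (1 : M) k) (f a)) (w : FreeMonoid A) (k : K) :
    extendLetters K f hf (single w k) = single 1 k * FreeMonoid.lift f w := by
  simp [extendLetters, singleOneRingHom]

theorem coprod_single (w : FreeMonoid A) (k : K) :
    coprod A K (single w k) = single 1 k * FreeMonoid.lift
      (fun a => single (FreeMonoid.of a, 1) (1 : K) + single (1, FreeMonoid.of a) 1) w :=
  extendLetters_single _ _ w k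

theorem magnus_single (w : FreeMonoid A) (k : K) :
    magnus A K (single w k) =
      single 1 k * FreeMonoid.lift (fun a => 1 + single (FreeMonoid.of a) (1 : K)) w :=
  extendLetters_single _ _ w k

theorem coprod_single_eq_sum_splits (l : List A) :
    coprod A K (single (FreeMonoid.ofList l) 1) =
      ((splits l).map fun p => single (FreeMonoid.ofList p.1, FreeMonoid.ofList p.2) (1 : K)).sum := by
  rw [coprod_single, ← one_def, one_mul]
  induction l with
  | nil => simp [splits, one_def, Prod.one_eq_mk]
  | cons a l ih =>
    rw [FreeMonoid.ofList_cons, map_mul, ih, FreeMonoid.lift_eval_of, add_mul,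
      ← List.sum_map_mul_left, ← List.sum_map_mul_left, splits, List.map_append, List.sum_append,
      List.map_map, List.map_map]
    simp [Function.comp_def, single_mul_single]

open Classical in
theorem coeff_coprod_single (l x y : List A) :
    (coprod A K (single (FreeMonoid.ofList l) 1)).coeff
      (FreeMonoid.ofList x, FreeMonoid.ofList y) = ((splits l).count (x, y) : K) := by
  rw [coprod_single_eq_sum_splits]
  induction splits l with
  | nil => simp
  | cons p s ih =>
    rw [List.map_cons, List.sum_cons, coeff_add, Finsupp.add_apply, ih, List.count_cons]
    obtain ⟨p, q⟩ := p
    rw [coeff_single, Finsupp.single_apply]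
    by_cases h : p = x ∧ q = y
    · simp [h, add_comm]
    · simp [h]

/-- Sending every word of the second factor to 1 turns `a ⊗ 1 + 1 ⊗ a` into `a + 1`. -/
theorem mapDomain_fst_comp_coprod :
    (mapDomainRingHom K (MonoidHom.fst (FreeMonoid A) (FreeMonoid A))).comp (coprod A K) =
      magnus A K := by
  refine ringHom_ext (fun k => ?_) fun w => ?_
  · simp [coprod_single, magnus_single]
  · simp only [RingHom.comp_apply, coprod_single, magnus_single, ← one_def, one_mul]
    induction w using FreeMonoid.inductionOn' with
    | one => simp only [map_one]
    | of_mul a w ih =>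
      simp only [map_mul, ih, FreeMonoid.lift_eval_of, map_add, mapDomainRingHom_apply,
        mapDomain_single, MonoidHom.coe_fst, one_def, add_comm]

end Semiring

section Ring

variable {A : Type*} {K : Type*} [Ring K]

theorem IsPrimitive.coprod_sub {u v : FreeMonoid A}
    (h : IsPrimitive (single u (1 : K) - single v 1)) :
    coprod A K (single u 1) - coprod A K (single v 1) =
      single (u, 1) 1 - single (v, 1) 1 + (single (1, u) 1 - single (1, v) 1) := by
  rw [IsPrimitive] at h
  simpa only [map_sub, mapDomainRingHom_apply, mapDomain_single, MonoidHom.inl_apply,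
    MonoidHom.inr_apply] using h

open Classical in
theorem IsPrimitive.count_splits_sub {u v : List A}
    (h : IsPrimitive (single (FreeMonoid.ofList u) (1 : K) - single (FreeMonoid.ofList v) 1))
    (x y : List A) :
    ((splits u).count (x, y) : K) - (splits v).count (x, y) =
      (if u = x ∧ [] = y then 1 else 0) - (if v = x ∧ [] = y then 1 else 0) +
        ((if [] = x ∧ u = y then 1 else 0) - (if [] = x ∧ v = y then 1 else 0)) := by
  have h1 : ∀ l : List A, 1 = FreeMonoid.ofList l ↔ [] = l := fun l => Iff.rfl
  have := congrArg (fun f => f.coeff (FreeMonoid.ofList x, FreeMonoid.ofList y)) h.coprod_sub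
  simpa only [coeff_sub, coeff_add, coeff_coprod_single, coeff_single, Finsupp.sub_apply,
    Finsupp.add_apply, Finsupp.single_apply, Prod.mk.injEq, h1,
    FreeMonoid.ofList.injective.eq_iff] using this

open Classical in
theorem IsPrimitive.count_splits_eq {u v : List A}
    (h : IsPrimitive (single (FreeMonoid.ofList u) (1 : K) - single (FreeMonoid.ofList v) 1))
    {x y : List A} (hx : x ≠ []) (hy : y ≠ []) :
    ((splits u).count (x, y) : K) = (splits v).count (x, y) := by
  simpa [hx.symm, hy.symm, sub_eq_zero] using h.count_splits_sub x y

theorem count_nil_splits [DecidableEq A] (l : List A) :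
    (splits l).count ([], []) = if l = [] then 1 else 0 := by
  split_ifs with h
  · simp [h, splits]
  · refine List.count_eq_zero.2 fun hm => h ?_
    simpa using perm_of_mem_splits hm

/-- Compare coefficients at `1 ⊗ 1`: if exactly one of the words were empty, the identity would read
`1 = 2` up to sign. -/
theorem IsPrimitive.eq_nil_iff [Nontrivial K] {u v : List A}
    (h : IsPrimitive (single (FreeMonoid.ofList u) (1 : K) - single (FreeMonoid.ofList v) 1)) :
    u = [] ↔ v = [] := by
  classical
  have := h.count_splits_sub [] []
  by_cases hu : u = [] <;> by_cases hv : v = [] <;>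
    simp [count_nil_splits, hu, hv] at this ⊢

/-- Separate the occurrences of `a` from the other letters. Both parts are nonempty thanks to `b`,
and the count 1 for `u` forces a nonzero count for `v`. -/
theorem perm_of_count_splits_eq [Nontrivial K] [DecidableEq A] {u v : List A}
    (h : ∀ x y : List A, x ≠ [] → y ≠ [] →
      ((splits u).count (x, y) : K) = (splits v).count (x, y))
    {a b : A} (ha : a ∈ u) (hb : b ∈ u) (hab : b ≠ a) : u.Perm v := by
  have hu := count_splits_filter (· = a) u
  have hv := h (u.filter (· = a)) (u.filter (¬ · = a))
    (List.ne_nil_of_mem (List.mem_filter.2 ⟨ha, by simp⟩))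
    (List.ne_nil_of_mem (List.mem_filter.2 ⟨hb, by simpa using hab⟩))
  rw [hu] at hv
  have hmem : (u.filter (· = a), u.filter (¬ · = a)) ∈ splits v := by
    by_contra hm
    rw [List.count_eq_zero.2 hm] at hv
    simp at hv
  exact (perm_of_mem_splits (List.count_pos_iff.1 (hu ▸ Nat.one_pos))).symm.trans
    (perm_of_mem_splits hmem)

/-- If `u - v` is primitive, then `u` and `v` have the same commutative image, or are both
powers of letters. -/
theorem IsPrimitive.perm_or_pow [Nontrivial K] {u v : FreeMonoid A}
    (h : IsPrimitive (single u (1 : K) - single v 1)) :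
    u.toList.Perm v.toList ∨ ∃ (a b : A) (i j : ℕ), 0 < i ∧ 0 < j ∧
      u = FreeMonoid.of a ^ i ∧ v = FreeMonoid.of b ^ j := by
  classical
  have hpow : ∀ w : FreeMonoid A, w.toList ≠ [] → (∃ a ∈ w.toList, ∃ b ∈ w.toList, b ≠ a) ∨
      ∃ (a : A) (i : ℕ), 0 < i ∧ w = FreeMonoid.of a ^ i := by
    intro w hw
    by_cases hc : ∃ a ∈ w.toList, ∃ b ∈ w.toList, b ≠ a
    · exact Or.inl hc
    · push Not at hc
      obtain ⟨a, ha⟩ := List.exists_mem_of_ne_nil _ hw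
      refine Or.inr ⟨a, w.toList.length, List.length_pos_iff.2 hw, ?_⟩
      apply FreeMonoid.toList.injective
      rw [toList_of_pow]
      exact List.eq_replicate_of_mem (hc a ha)
  have hcount : ∀ x y : List A, x ≠ [] → y ≠ [] →
      ((splits u.toList).count (x, y) : K) = (splits v.toList).count (x, y) :=
    fun x y => IsPrimitive.count_splits_eq (u := u.toList) (v := v.toList) h
  have hnil : u.toList = [] ↔ v.toList = [] :=
    IsPrimitive.eq_nil_iff (u := u.toList) (v := v.toList) h
  by_cases hu : u.toList = []
  · left; rw [hu, hnil.1 hu]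
  rcases hpow u hu with ⟨a, ha, b, hb, hab⟩ | ⟨a, i, hi, hui⟩
  · exact Or.inl (perm_of_count_splits_eq hcount ha hb hab)
  rcases hpow v (mt hnil.2 hu) with ⟨a, ha, b, hb, hab⟩ | ⟨b, j, hj, hvj⟩
  · exact Or.inl
      (perm_of_count_splits_eq (fun x y hx hy => (hcount x y hx hy).symm) ha hb hab).symm
  · exact Or.inr ⟨a, b, i, j, hi, hj, hui, hvj⟩

/-- If `u - v` is primitive, then `μ u - μ v = u - v`. -/
theorem IsPrimitive.magnus_sub {u v : FreeMonoid A}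
    (h : IsPrimitive (single u (1 : K) - single v 1)) :
    magnus A K (single u 1) - magnus A K (single v 1) = single u 1 - single v 1 := by
  -- Under the first projection `1 ⊗ u` and `1 ⊗ v` both become 1 and cancel.
  rw [← map_sub, ← mapDomain_fst_comp_coprod, RingHom.comp_apply, map_sub,
    h.coprod_sub]
  simp only [map_sub, map_add, mapDomainRingHom_apply, mapDomain_single, MonoidHom.coe_fst,
    sub_self, add_zero]

end Ring

/-! ### The group of series with constant term 1 -/

section Series

variable {M : Type*} [Monoid M]

section Semiring

variable {K : Type*} [Semiring K]

theorem seriesMul_apply (hfin : ∀ m : M, {p : M × M | p.1 * p.2 = m}.Finite)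
    (S T : M → K) (m : M) :
    seriesMul S T m = ∑ p ∈ (hfin m).toFinset, S p.1 * T p.2 :=
  finsum_mem_eq_finite_toFinset_sum _ (hfin m)

theorem seriesMul_assoc (hfin : ∀ m : M, {p : M × M | p.1 * p.2 = m}.Finite)
    (S T U : M → K) :
    seriesMul (seriesMul S T) U = seriesMul S (seriesMul T U) := by
  funext m
  simp only [seriesMul_apply hfin, Finset.sum_mul, Finset.mul_sum]
  rw [Finset.sum_sigma', Finset.sum_sigma']
  refine Finset.sum_bij' (fun x _ => ⟨(x.2.1, x.2.2 * x.1.2), (x.2.2, x.1.2)⟩)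
    (fun x _ => ⟨(x.1.1 * x.2.1, x.2.2), (x.1.1, x.2.1)⟩) ?_ ?_ ?_ ?_ ?_
  · rintro ⟨⟨a, b⟩, ⟨c, d⟩⟩ h
    simp only [Finset.mem_sigma, Set.Finite.mem_toFinset, Set.mem_ofPred_eq] at h ⊢
    exact ⟨by rw [← mul_assoc, h.2, h.1], trivial⟩
  · rintro ⟨⟨a, b⟩, ⟨c, d⟩⟩ h
    simp only [Finset.mem_sigma, Set.Finite.mem_toFinset, Set.mem_ofPred_eq] at h ⊢
    exact ⟨by rw [mul_assoc, h.2, h.1], trivial⟩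
  · rintro ⟨⟨a, b⟩, ⟨c, d⟩⟩ h
    simp only [Finset.mem_sigma, Set.Finite.mem_toFinset, Set.mem_ofPred_eq] at h ⊢
    rw [h.2]
  · rintro ⟨⟨a, b⟩, ⟨c, d⟩⟩ h
    simp only [Finset.mem_sigma, Set.Finite.mem_toFinset, Set.mem_ofPred_eq] at h ⊢
    rw [h.2]
  · rintro ⟨⟨a, b⟩, ⟨c, d⟩⟩ h
    exact mul_assoc _ _ _

theorem seriesMul_one_right [DecidableEq M]
    (hfin : ∀ m : M, {p : M × M | p.1 * p.2 = m}.Finite) (S : M → K) :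
    seriesMul S (Pi.single 1 1) = S := by
  funext m
  rw [seriesMul_apply hfin, Finset.sum_eq_single (m, 1)]
  · simp
  · rintro ⟨a, b⟩ h hne
    simp only [Set.Finite.mem_toFinset, Set.mem_ofPred_eq] at h
    have : b ≠ 1 := by
      rintro rfl
      exact hne (by rw [← h, mul_one])
    simp [this]
  · simp

theorem seriesMul_coeff (hfin : ∀ m : M, {p : M × M | p.1 * p.2 = m}.Finite)
    (f g : MonoidAlgebra K M) :
    seriesMul (fun m => f.coeff m) (fun m => g.coeff m) = fun m => (f * g).coeff m := by
  funext m
  rw [seriesMul_apply hfin, coeff_mul_antidiag f g m (hfin m).toFinset (by simp)]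

end Semiring

/-- An additive weight that vanishes only at `1`, on a monoid all of whose elements have finitely
many factorizations. -/
structure IsFactorizationWeight (wt : M → ℕ) : Prop where
  finite : ∀ m : M, {p : M × M | p.1 * p.2 = m}.Finite
  map_mul : ∀ x y, wt (x * y) = wt x + wt y
  eq_zero_iff : ∀ x, wt x = 0 ↔ x = 1

section Semiring

variable {K : Type*} [Semiring K]

theorem seriesMul_apply_one {wt : M → ℕ} (hwt : IsFactorizationWeight wt)
    (S T : M → K) : seriesMul S T 1 = S 1 * T 1 := by
  rw [seriesMul_apply hwt.finite, Finset.sum_eq_single (1, 1)]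
  · rintro ⟨a, b⟩ h hne
    simp only [Set.Finite.mem_toFinset, Set.mem_ofPred_eq] at h
    have h0 := hwt.map_mul a b
    rw [h, (hwt.eq_zero_iff 1).2 rfl] at h0
    exact absurd (Prod.ext ((hwt.eq_zero_iff a).1 (by omega)) ((hwt.eq_zero_iff b).1 (by omega))) hne
  · simp

end Semiring

variable {K : Type*} [Ring K]

open Classical in
/-- The right inverse of a series with constant term `1`. -/
def seriesInv {wt : M → ℕ} (hwt : IsFactorizationWeight wt) (S : M → K) (m : M) : K :=
  if m = 1 then 1
  else -∑ p ∈ ((hwt.finite m).toFinset.erase (1, m)).attach, S p.1.1 * seriesInv hwt S p.1.2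
termination_by wt m
-- If `a * b = m` and `(a, b) ≠ (1, m)`, then `a ≠ 1` has positive weight, so `b` is lighter than
-- `m`.
decreasing_by
  obtain ⟨⟨a, b⟩, h⟩ := p
  simp only [Finset.mem_erase, Set.Finite.mem_toFinset, Set.mem_ofPred_eq] at h
  obtain ⟨hne, rfl⟩ := h
  have ha : wt a ≠ 0 := fun h0 => hne (by rw [(hwt.eq_zero_iff a).1 h0, one_mul])
  have := hwt.map_mul a b
  simp only
  omega

open Classical in
theorem seriesMul_seriesInv {wt : M → ℕ} (hwt : IsFactorizationWeight wt)
    (S : M → K) (hS : S 1 = 1) :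
    seriesMul S (seriesInv hwt S) = Pi.single 1 1 := by
  funext m
  by_cases hm : m = 1
  · subst hm
    rw [seriesMul_apply_one hwt, seriesInv]
    simp [hS]
  · have h1 : (1, m) ∈ (hwt.finite m).toFinset := by simp
    rw [seriesMul_apply hwt.finite, ← Finset.add_sum_erase _ _ h1, seriesInv, if_neg hm, hS, one_mul,
      Finset.sum_attach _ (fun p : M × M => S p.1 * seriesInv hwt S p.2)]
    simp [hm]

theorem exists_group_magnusSeries {wt : M → ℕ} (hwt : IsFactorizationWeight wt) (K : Type*) [Ring K] :
    ∃ _ : Group (MagnusSeries M K),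
      ∀ S T : MagnusSeries M K, (S * T).val = seriesMul S.val T.val := by
  classical
  let : Mul (MagnusSeries M K) := ⟨fun S T => ⟨seriesMul S.val T.val, by
    rw [seriesMul_apply_one hwt, S.2, T.2, one_mul]⟩⟩
  let : One (MagnusSeries M K) := ⟨⟨Pi.single 1 1, by simp⟩⟩
  let : Inv (MagnusSeries M K) := ⟨fun S => ⟨seriesInv hwt S.val, by
    rw [seriesInv, if_pos rfl]⟩⟩
  -- A right identity and right inverses suffice in the presence of associativity.
  exact ⟨Group.ofRightAxioms
    (fun S T U => Subtype.ext (seriesMul_assoc hwt.finite S.val T.val U.val))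
    (fun S => Subtype.ext (seriesMul_one_right hwt.finite S.val))
    (fun S => Subtype.ext (seriesMul_seriesInv hwt S.val S.2)),
    fun S T => rfl⟩

end Series

/-! ### Construction of the weight and finiteness of factorizations -/

section Weight

variable {A : Type*}

theorem weight_one (ω : A → ℕ+) : weight ω 1 = 0 := by simp [weight]

theorem weight_of (ω : A → ℕ+) (a : A) : weight ω (FreeMonoid.of a) = ω a := by simp [weight]

theorem weight_mul (ω : A → ℕ+) (u v : FreeMonoid A) :
    weight ω (u * v) = weight ω u + weight ω v := by simp [weight]

theorem weight_of_pow (ω : A → ℕ+) (a : A) (n : ℕ) :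
    weight ω (FreeMonoid.of a ^ n) = n * ω a := by
  rw [weight, toList_of_pow]; simp

theorem length_le_weight (ω : A → ℕ+) (w : FreeMonoid A) : w.toList.length ≤ weight ω w := by
  rw [weight, ← List.length_map (f := fun a => (ω a : ℕ))]
  refine List.length_le_sum_of_one_le _ fun i hi => ?_
  obtain ⟨a, -, rfl⟩ := List.mem_map.1 hi
  exact one_le (a := ω a)

theorem weight_eq_zero_iff (ω : A → ℕ+) (w : FreeMonoid A) : weight ω w = 0 ↔ w = 1 := by
  refine ⟨fun h => ?_, fun h => h ▸ weight_one ω⟩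
  have := length_le_weight ω w
  rw [h, Nat.le_zero, List.length_eq_zero_iff] at this
  exact this

theorem weight_eq_of_perm (ω : A → ℕ+) {u v : FreeMonoid A} (h : u.toList.Perm v.toList) :
    weight ω u = weight ω v :=
  (h.map _).sum_eq

theorem homogeneous_generatedBy {R : Set (FreeMonoid A × FreeMonoid A)} {ω : A → ℕ+}
    (h : ∀ u v, (u, v) ∈ R → weight ω u = weight ω v) : Homogeneous (generatedBy R) ω := by
  let f : FreeMonoid A →* Multiplicative ℕ :=
    { toFun := fun w => Multiplicative.ofAdd (weight ω w)
      map_one' := by rw [weight_one]; rfl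
      map_mul' := fun u v => by rw [weight_mul]; rfl }
  have hle : generatedBy R ≤ Con.ker f :=
    Con.conGen_le.2 fun u v huv => congrArg Multiplicative.ofAdd (h u v huv)
  exact fun u v huv => congrArg Multiplicative.toAdd (hle huv)

theorem generatedBy_of_mem {R : Set (FreeMonoid A × FreeMonoid A)} {u v : FreeMonoid A}
    (h : (u, v) ∈ R) : generatedBy R u v :=
  ConGen.Rel.of _ _ h

open Classical in
/-- All but finitely many letters occur equally often in any two congruent words. -/
theorem FinitelyGenerated.exists_finset_letters {r : Con (FreeMonoid A)}
    (h : FinitelyGenerated r) :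
    ∃ F : Finset A, ∀ a ∉ F, ∀ u v : FreeMonoid A, r u v →
      u.toList.count a = v.toList.count a := by
  obtain ⟨R, hR, rfl⟩ := h
  refine ⟨hR.toFinset.biUnion fun p => p.1.toList.toFinset ∪ p.2.toList.toFinset,
    fun a ha u v huv => ?_⟩
  have hle : generatedBy R ≤ Con.ker (FreeMonoid.count a) := by
    refine Con.conGen_le.2 fun u v huv => ?_
    simp only [Finset.mem_biUnion, Set.Finite.mem_toFinset, Finset.mem_union, List.mem_toFinset,
      not_exists, not_and, not_or] at ha
    obtain ⟨h1, h2⟩ := ha _ huv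
    refine congrArg Multiplicative.ofAdd ?_
    exact (List.count_eq_zero.2 h1).trans (List.count_eq_zero.2 h2).symm
  exact congrArg Multiplicative.toAdd (hle huv)

/-- "Both empty or both nonempty" is a congruence on words, and it contains the relators. -/
theorem PrimitivelyGenerated.eq_one_of_rel {K : Type*} [Ring K] [Nontrivial K]
    {r : Con (FreeMonoid A)} (h : PrimitivelyGenerated K r) {u : FreeMonoid A} (hu : r u 1) :
    u = 1 := by
  obtain ⟨R, hR, rfl⟩ := h
  let c : Con (FreeMonoid A) :=
    { r := fun u v => u = 1 ↔ v = 1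
      iseqv := ⟨fun _ => Iff.rfl, Iff.symm, Iff.trans⟩
      mul' := fun {u v x y} h₁ h₂ => by
        have key : ∀ u v : FreeMonoid A, u * v = 1 ↔ u = 1 ∧ v = 1 :=
          fun u v => List.append_eq_nil_iff
        rw [key, key, h₁, h₂] }
  have hle : generatedBy R ≤ c := Con.conGen_le.2 fun u v huv =>
    IsPrimitive.eq_nil_iff (u := u.toList) (v := v.toList) (hR u v huv)
  exact (hle hu).2 rfl

theorem PrimitivelyGenerated.injective_pow {K : Type*} [Ring K] [Nontrivial K]
    {r : Con (FreeMonoid A)} [IsCancelMul r.Quotient] (h : PrimitivelyGenerated K r) (a : A) :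
    Function.Injective fun n : ℕ => r.mk' (FreeMonoid.of a) ^ n := by
  have key : ∀ i j : ℕ, i < j → r.mk' (FreeMonoid.of a) ^ i ≠ r.mk' (FreeMonoid.of a) ^ j := by
    intro i j hij heq
    obtain ⟨k, rfl⟩ := Nat.exists_eq_add_of_lt hij
    rw [add_assoc, pow_add, left_eq_mul, ← map_pow, ← map_one r.mk'] at heq
    have h1 := h.eq_one_of_rel (r.eq.1 heq)
    have := congrArg (fun w => w.toList.length) h1
    simp [toList_of_pow] at this
  intro i j hij
  by_contra hne
  rcases Nat.lt_or_gt_of_ne hne with hlt | hlt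
  · exact key i j hlt hij
  · exact key j i hlt hij.symm

/-- Letters are equivalent if some positive powers of them agree in the monoid `M`. -/
def commensurable {M : Type*} [Monoid M] (q : A → M) : Setoid A where
  r a b := ∃ i j : ℕ, 0 < i ∧ 0 < j ∧ q a ^ i = q b ^ j
  iseqv := by
    refine ⟨fun a => ⟨1, 1, one_pos, one_pos, rfl⟩, ?_, ?_⟩
    · rintro a b ⟨i, j, hi, hj, h⟩
      exact ⟨j, i, hj, hi, h.symm⟩
    · rintro a b c ⟨i, j, hi, hj, h⟩ ⟨k, l, hk, hl, h'⟩
      refine ⟨i * k, l * j, by positivity, by positivity, ?_⟩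
      rw [pow_mul, h, ← pow_mul, mul_comm, pow_mul, h', ← pow_mul]

/-- A weight on finitely many letters that is compatible with all equalities between powers of
letters in a monoid where letters have infinite order. -/
theorem exists_weight_of_injective_pow {M : Type*} [Monoid M] (q : A → M)
    (hq : ∀ a, Function.Injective fun n : ℕ => q a ^ n) (F : Finset A) :
    ∃ ω : A → ℕ+, (∀ a ∈ F, ∀ b ∈ F, ∀ i j : ℕ, 0 < i → 0 < j → q a ^ i = q b ^ j →
      i * (ω a : ℕ) = j * ω b) := by
  classical
  let s := commensurable q
  have hrep : ∀ a, ∃ k l : ℕ, 0 < k ∧ 0 < l ∧ q (Quotient.mk s a).out ^ k = q a ^ l :=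
    fun a => Quotient.mk_out (s := s) a
  choose k l hk hl hkl using hrep
  have hN : 0 < ∏ a ∈ F, l a := Finset.prod_pos fun a _ => hl a
  have hdvd : ∀ a ∈ F, l a * ((∏ a ∈ F, l a) / l a) = ∏ a ∈ F, l a :=
    fun a ha => Nat.mul_div_cancel' (Finset.dvd_prod_of_mem l ha)
  generalize ∏ a ∈ F, l a = N at hN hdvd
  have hpos : ∀ a ∈ F, 0 < k a * (N / l a) := fun a ha =>
    Nat.mul_pos (hk a) (Nat.pos_of_mul_pos_left (hdvd a ha ▸ hN))
  -- If `ρ` represents the class of `a` and `ρ ^ k = a ^ l`, then `a` should weigh `k / l` times as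
  -- much as `ρ`; the factor `N` clears the denominators over `F`. Outside `F` the value is
  -- irrelevant, and `toPNat'` only keeps it positive.
  refine ⟨fun a => (k a * (N / l a)).toPNat', fun a ha b hb i j hi hj hij => ?_⟩
  rw [Nat.toPNat'_coe, Nat.toPNat'_coe, if_pos (hpos a ha), if_pos (hpos b hb)]
  have hab : Quotient.mk s a = Quotient.mk s b := Quotient.sound (s := s) ⟨i, j, hi, hj, hij⟩
  have h1 := hkl a
  have h2 := hkl b
  rw [← hab] at h2
  -- Both sides are exponents of the common representative, which has infinite order.
  have h3 : k a * (i * l b) = k b * (j * l a) := by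
    apply hq (Quotient.mk s a).out
    simp only
    rw [pow_mul, h1, pow_mul _ (k b), h2, ← pow_mul, ← pow_mul, mul_left_comm, pow_mul, hij,
      ← pow_mul]
    congr 1; ring
  have h4 := hdvd a ha
  have h5 := hdvd b hb
  apply Nat.eq_of_mul_eq_mul_left (Nat.mul_pos (hl a) (hl b))
  calc l a * l b * (i * (k a * (N / l a))) = k a * (i * l b) * (l a * (N / l a)) := by ring
    _ = k b * (j * l a) * (l b * (N / l b)) := by rw [h3, h4, h5]
    _ = l a * l b * (j * (k b * (N / l b))) := by ring

theorem eq_of_count_of_pow [DecidableEq A] {a b : A} {i j : ℕ} (hi : 0 < i)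
    (h : (FreeMonoid.of a ^ i).toList.count a = (FreeMonoid.of b ^ j).toList.count a) :
    FreeMonoid.of a ^ i = FreeMonoid.of b ^ j := by
  rw [toList_of_pow, toList_of_pow, List.count_replicate_self, List.count_replicate] at h
  split_ifs at h with hab
  · rw [h, beq_iff_eq.1 hab]
  · omega

theorem exists_homogeneous {K : Type*} [Ring K] [Nontrivial K] {r : Con (FreeMonoid A)}
    [IsCancelMul r.Quotient] (hfg : FinitelyGenerated r) (hprim : PrimitivelyGenerated K r) :
    ∃ ω : A → ℕ+, Homogeneous r ω := by
  classical
  -- `F` comes from a finite generating set, whereas the primitive relators may be infinitely many.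
  -- Those of the form `a ^ i ≡ b ^ j` with a letter outside `F` are trivial.
  obtain ⟨F, hF⟩ := hfg.exists_finset_letters
  obtain ⟨ω, hω⟩ := exists_weight_of_injective_pow (fun a => r.mk' (FreeMonoid.of a))
    hprim.injective_pow F
  obtain ⟨R, hR, rfl⟩ := hprim
  refine ⟨ω, homogeneous_generatedBy fun u v huv => ?_⟩
  have hrel := generatedBy_of_mem huv
  rcases (hR u v huv).perm_or_pow with hperm | ⟨a, b, i, j, hi, hj, rfl, rfl⟩
  · exact weight_eq_of_perm ω hperm
  by_cases ha : a ∈ F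
  · by_cases hb : b ∈ F
    · rw [weight_of_pow, weight_of_pow]
      refine hω a ha b hb i j hi hj ?_
      rw [← map_pow, ← map_pow]
      exact (Con.eq _).2 hrel
    · rw [eq_of_count_of_pow hj (hF b hb _ _ hrel).symm]
  · rw [eq_of_count_of_pow hi (hF a ha _ _ hrel)]

/-- The weight of an element of `A*/≡`. -/
def quotientWeight {r : Con (FreeMonoid A)} {ω : A → ℕ+} (h : Homogeneous r ω)
    (m : r.Quotient) : ℕ :=
  Con.liftOn m (weight ω) h

theorem quotientWeight_mk {r : Con (FreeMonoid A)} {ω : A → ℕ+} (h : Homogeneous r ω)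
    (w : FreeMonoid A) : quotientWeight h (r.mk' w) = weight ω w := rfl

/-- If `u * v ≡ w`, the weight of `w` bounds the lengths of `u` and `v`, and their letters lie in
`F` or occur in `w`: finitely many words remain even over an infinite alphabet. -/
theorem finite_factorizations {r : Con (FreeMonoid A)} {ω : A → ℕ+} (h : Homogeneous r ω)
    (hfg : FinitelyGenerated r) (m : r.Quotient) :
    {p : r.Quotient × r.Quotient | p.1 * p.2 = m}.Finite := by
  classical
  obtain ⟨F, hF⟩ := hfg.exists_finset_letters
  obtain ⟨w, rfl⟩ := r.mk'_surjective m
  let G := F ∪ w.toList.toFinset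
  let S : Set (List A) :=
    (fun l : List G => l.map Subtype.val) '' {l | l.length ≤ weight ω w}
  have hS : S.Finite := (List.finite_length_le G (weight ω w)).image _
  have hmem : ∀ u v : FreeMonoid A, r (u * v) w →
      u.toList ∈ S ∧ v.toList ∈ S := by
    intro u v huv
    have hlen : (u.toList ++ v.toList).length ≤ weight ω w := by
      rw [← h _ _ huv]; exact length_le_weight ω (u * v)
    have hlet : ∀ a ∈ u.toList ++ v.toList, a ∈ G := by
      intro a ha
      by_cases haF : a ∈ F
      · exact Finset.mem_union_left _ haF
      · refine Finset.mem_union_right _ (List.mem_toFinset.2 (List.count_pos_iff.1 ?_))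
        rw [← hF a haF _ _ huv]
        exact List.count_pos_iff.2 ha
    rw [List.length_append] at hlen
    have key : ∀ l : List A, l.length ≤ weight ω w → (∀ a ∈ l, a ∈ G) → l ∈ S :=
      fun l hl hG => ⟨l.attachWith (· ∈ G) hG, by simpa using hl, by simp⟩
    exact ⟨key _ (by omega) fun a ha => hlet a (List.mem_append_left _ ha),
      key _ (by omega) fun a ha => hlet a (List.mem_append_right _ ha)⟩
  refine ((hS.prod hS).image fun p : List A × List A =>
    (r.mk' (FreeMonoid.ofList p.1), r.mk' (FreeMonoid.ofList p.2))).subset ?_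
  rintro ⟨x, y⟩ hxy
  obtain ⟨u, rfl⟩ := r.mk'_surjective x
  obtain ⟨v, rfl⟩ := r.mk'_surjective y
  refine ⟨(u.toList, v.toList), Set.mk_mem_prod ?_ ?_, rfl⟩
  · exact (hmem u v ((Con.eq _).1 hxy)).1
  · exact (hmem u v ((Con.eq _).1 hxy)).2

theorem isFactorizationWeight_quotientWeight {r : Con (FreeMonoid A)} {ω : A → ℕ+}
    (h : Homogeneous r ω) (hfg : FinitelyGenerated r) :
    IsFactorizationWeight (quotientWeight h) where
  finite := finite_factorizations h hfg
  map_mul x y := by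
    obtain ⟨u, rfl⟩ := r.mk'_surjective x
    obtain ⟨v, rfl⟩ := r.mk'_surjective y
    rw [← map_mul, quotientWeight_mk, quotientWeight_mk, quotientWeight_mk, weight_mul]
  eq_zero_iff x := by
    obtain ⟨u, rfl⟩ := r.mk'_surjective x
    rw [quotientWeight_mk, weight_eq_zero_iff]
    refine ⟨fun hu => by rw [hu, map_one], fun hu => (weight_eq_zero_iff ω u).1 ?_⟩
    rw [← map_one r.mk'] at hu
    rw [h _ _ ((Con.eq _).1 hu), weight_one]

end Weight

/-! ### The induced Magnus transformation and its injectivity -/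

section InducedMagnus

variable {A : Type*} {K : Type*} [Ring K] {r : Con (FreeMonoid A)}

theorem nat_single (w : FreeMonoid A) (k : K) : nat K r (single w k) = single (r.mk' w) k := by
  rw [nat, mapDomainRingHom_apply, mapDomain_single]

theorem nat_magnus_one : nat K r (magnus A K (single 1 1)) = 1 := by
  rw [← one_def, map_one, map_one]

theorem nat_magnus_of_mul (a : A) (w : FreeMonoid A) :
    nat K r (magnus A K (single (FreeMonoid.of a * w) 1)) =
      nat K r (magnus A K (single w 1)) +
        single (r.mk' (FreeMonoid.of a)) 1 * nat K r (magnus A K (single w 1)) := by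
  have h : magnus A K (single (FreeMonoid.of a) 1) = 1 + single (FreeMonoid.of a) 1 := by
    rw [magnus_single, ← one_def, one_mul, FreeMonoid.lift_eval_of]
  have hs : single (FreeMonoid.of a * w) (1 : K) = single (FreeMonoid.of a) 1 * single w 1 := by
    rw [single_mul_single, one_mul]
  rw [hs, map_mul, map_mul, h, map_add, map_one, nat_single, add_mul, one_mul]

/-- On a relator, `nat (μ u - μ v) = nat (u - v) = 0`; being the kernel of a monoid morphism, the
relation extends to the whole congruence. -/
theorem PrimitivelyGenerated.nat_magnus_eq (h : PrimitivelyGenerated K r) {u v : FreeMonoid A}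
    (huv : r u v) :
    nat K r (magnus A K (single u 1)) = nat K r (magnus A K (single v 1)) := by
  obtain ⟨R, hR, hr⟩ := h
  let f : FreeMonoid A →* MonoidAlgebra K r.Quotient :=
    (((nat K r).comp (magnus A K) : _ →+* _) : _ →* _).comp (MonoidAlgebra.of K (FreeMonoid A))
  have hle : generatedBy R ≤ Con.ker f := by
    refine Con.conGen_le.2 fun u v huv => ?_
    have huv' : r.mk' u = r.mk' v := (Con.eq _).2 (hr ▸ generatedBy_of_mem huv)
    change nat K r (magnus A K (single u 1)) = nat K r (magnus A K (single v 1))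
    rw [← sub_eq_zero, ← map_sub, (hR u v huv).magnus_sub, map_sub, nat_single, nat_single, huv',
      sub_self]
  exact hle (hr ▸ huv)

theorem PrimitivelyGenerated.exists_magnusHom (h : PrimitivelyGenerated K r) :
    ∃ g : r.Quotient →* MonoidAlgebra K r.Quotient,
      ∀ w, g (r.mk' w) = nat K r (magnus A K (single w 1)) :=
  let f : FreeMonoid A →* MonoidAlgebra K r.Quotient :=
    (((nat K r).comp (magnus A K) : _ →+* _) : _ →* _).comp (MonoidAlgebra.of K (FreeMonoid A))
  have hle : r ≤ Con.ker f := fun _ _ huv => (Con.ker_rel f).2 (h.nat_magnus_eq huv)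
  ⟨r.lift f hle, fun _ => rfl⟩

theorem nat_magnus_scalar (k : K) : nat K r (magnus A K (single 1 k)) = single 1 k := by
  rw [magnus_single, map_one, mul_one, nat_single, map_one]

theorem PrimitivelyGenerated.exists_isInducedMagnus (h : PrimitivelyGenerated K r) :
    ∃ μ' : MonoidAlgebra K r.Quotient →+* MonoidAlgebra K r.Quotient, IsInducedMagnus r μ' := by
  obtain ⟨g, hg⟩ := h.exists_magnusHom
  have hk : ∀ k : K, (singleOneRingHom : K →+* MonoidAlgebra K r.Quotient) k = single 1 k :=
    fun _ => rfl
  have hcomm : ∀ (k : K) (m : r.Quotient),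
      Commute ((singleOneRingHom : K →+* MonoidAlgebra K r.Quotient) k) (g m) := by
    intro k m
    obtain ⟨w, rfl⟩ := r.mk'_surjective m
    rw [hk, hg, ← nat_magnus_scalar k]
    refine Commute.map (Commute.map ?_ _) _
    exact single_commute_single (Commute.one_left w) (Commute.one_right k)
  obtain ⟨μ', hμ'⟩ : ∃ μ' : MonoidAlgebra K r.Quotient →+* MonoidAlgebra K r.Quotient,
      ∀ m k, μ' (single m k) = single 1 k * g m :=
    ⟨liftNCRingHom singleOneRingHom g hcomm, fun m k => liftNCRingHom_single _ _ hcomm m k⟩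
  refine ⟨μ', fun P => ?_⟩
  induction P using MonoidAlgebra.induction_linear with
  | zero => simp only [map_zero]
  | add P Q hP hQ => simp only [map_add, hP, hQ]
  | single w k =>
    have hw : single w k = single 1 k * single w (1 : K) := by
      rw [single_mul_single, one_mul, mul_one]
    rw [nat_single, hμ', hw, map_mul, map_mul, nat_magnus_scalar, hg]

theorem coeff_one_nat_magnus {ω : A → ℕ+} (h : Homogeneous r ω) (w : FreeMonoid A) :
    (nat K r (magnus A K (single w 1))).coeff 1 = 1 := by
  induction w using FreeMonoid.inductionOn' with
  | one => rw [nat_magnus_one, coeff_one_one]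
  | of_mul a w ih =>
    rw [nat_magnus_of_mul, coeff_add, Finsupp.add_apply, ih, coeff_single_mul_of_forall_mul_ne,
      add_zero]
    intro d hd
    obtain ⟨v, rfl⟩ := r.mk'_surjective d
    have := congrArg (quotientWeight h) hd
    rw [← map_mul, ← map_one r.mk', quotientWeight_mk, quotientWeight_mk, weight_mul, weight_of,
      weight_one] at this
    have := (ω a).pos
    omega

open Classical in
/-- The component of `μ w` in weights at least `ω w` is `w`. -/
theorem coeff_nat_magnus_of_weight_le [IsCancelMul r.Quotient] {ω : A → ℕ+}
    (h : Homogeneous r ω) (w : FreeMonoid A) (x : r.Quotient)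
    (hx : weight ω w ≤ quotientWeight h x) :
    (nat K r (magnus A K (single w 1))).coeff x = if x = r.mk' w then 1 else 0 := by
  induction w using FreeMonoid.inductionOn' generalizing x with
  | one => rw [nat_magnus_one, one_def, coeff_single, Finsupp.single_apply, map_one]; simp [eq_comm]
  | of_mul a w ih =>
    have ha := (ω a).pos
    rw [weight_mul, weight_of] at hx
    -- In `μ (a w) = μ w + a μ w` the first summand has no term as heavy as `x`.
    have hne : x ≠ r.mk' w := by
      rintro rfl
      rw [quotientWeight_mk] at hx
      omega
    rw [nat_magnus_of_mul, coeff_add, Finsupp.add_apply, ih x (by omega), if_neg hne, zero_add,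
      map_mul]
    by_cases hd : ∃ d, r.mk' (FreeMonoid.of a) * d = x
    · obtain ⟨d, rfl⟩ := hd
      have hw : weight ω w ≤ quotientWeight h d := by
        obtain ⟨v, rfl⟩ := r.mk'_surjective d
        rw [← map_mul, quotientWeight_mk, weight_mul, weight_of] at hx
        rw [quotientWeight_mk]
        omega
      -- By left cancellation, only `d` contributes to the coefficient of `a d`.
      rw [coeff_single_mul_eq_mul_coeff d (fun _ _ => mul_right_inj _), one_mul, ih d hw]
      simp only [mul_right_inj]
    · push Not at hd
      rw [coeff_single_mul_of_forall_mul_ne _ _ hd, if_neg fun hx => hd _ hx.symm]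

theorem embedsInMagnusGroup [Nontrivial K] [IsCancelMul r.Quotient] {ω : A → ℕ+}
    (h : Homogeneous r ω) (hfg : FinitelyGenerated r) (hprim : PrimitivelyGenerated K r) :
    EmbedsInMagnusGroup K r := by
  have hwt := isFactorizationWeight_quotientWeight h hfg
  obtain ⟨G, hG⟩ := exists_group_magnusSeries hwt K
  obtain ⟨μ', hμ'⟩ := hprim.exists_isInducedMagnus
  have hsingle : ∀ w, μ' (single (r.mk' w) 1) = nat K r (magnus A K (single w 1)) := by
    intro w
    rw [← hμ', nat_single]
  have hone : ∀ m, (μ' (single m 1)).coeff 1 = 1 := by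
    intro m
    obtain ⟨w, rfl⟩ := r.mk'_surjective m
    rw [hsingle, coeff_one_nat_magnus h]
  let φ : r.Quotient →* MagnusSeries r.Quotient K :=
    MonoidHom.mk' (fun m => ⟨fun x => (μ' (single m 1)).coeff x, hone m⟩) fun m n => by
      refine Subtype.ext ((funext fun x => ?_ : _ = _).trans (hG _ _).symm)
      rw [seriesMul_coeff hwt.finite, ← map_mul, single_mul_single, one_mul]
  refine ⟨hwt.finite, G, hG, μ', hμ', φ, ?_, fun m x => rfl⟩
  -- Evaluate at the heavier element `n`: the image of `n` has coefficient 1 there, that of `m` has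
  -- 0 unless `m = n`.
  have key : ∀ m n, quotientWeight h m ≤ quotientWeight h n → φ m = φ n → n = m := by
    intro m n hmn heq
    have heq' := congrFun (congrArg Subtype.val heq) n
    change (μ' (single m 1)).coeff n = (μ' (single n 1)).coeff n at heq'
    obtain ⟨u, rfl⟩ := r.mk'_surjective m
    obtain ⟨v, rfl⟩ := r.mk'_surjective n
    rw [hsingle, hsingle, coeff_nat_magnus_of_weight_le h u _ hmn,
      coeff_nat_magnus_of_weight_le h v _ le_rfl, if_pos rfl] at heq'
    by_contra hne
    rw [if_neg hne] at heq'
    exact zero_ne_one heq'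
  intro m n hmn
  rcases le_total (quotientWeight h m) (quotientWeight h n) with hle | hle
  · exact (key m n hle hmn).symm
  · exact key n m hle hmn.symm

end InducedMagnus

end ShuffleCongruence

end

theorem theorem2 {A : Type*} {K : Type*} [Ring K] [Nontrivial K] (r : Con (FreeMonoid A))
    (hfg : ShuffleCongruence.FinitelyGenerated r)
    (hcomp : ShuffleCongruence.ShuffleCompatible K r)
    (hprim : ShuffleCongruence.PrimitivelyGenerated K r) :
    ¬ IsCancelMul r.Quotient ∨
      ∃ ω : A → ℕ+, ShuffleCongruence.Homogeneous r ω ∧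
        ShuffleCongruence.EmbedsInMagnusGroup K r := by
  by_cases hc : IsCancelMul r.Quotient
  · obtain ⟨ω, hω⟩ := ShuffleCongruence.exists_homogeneous hfg hprim
    exact Or.inr ⟨ω, hω, ShuffleCongruence.embedsInMagnusGroup hω hfg hprim⟩
  · exact Or.inl hc
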